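/- Let $\mathcal X\subset\mathbb R^p$ be compact and let $\mathcal H_K$ be the reproducing kernel Hilbert space of a universal kernel $K$ on $\mathcal X$, i.e. $K:\mathcal X\times\mathcal X\to\mathbb R$ is continuous and $\mathcal H_K$ is dense in $C(\mathcal X)$ for the supremum norm. Let $(x,y)$ be a random pair with values in $\mathcal X\times\mathbb R^r$ following the nonparametric envelope model: $y=f(x)+\varepsilon$, where $f:\mathbb R^p\to\mathbb R^r$ is measurable with a domain $D\supseteq\mathcal X$, and $\varepsilon$ is independent of $x$, has mean zero and has a positive definite covariance matrix $\Sigma$. A subspace $\mathcal R\subseteq\mathbb R^r$, with orthogonal projections $P_{\mathcal R}$ onto $\mathcal R$ and $Q_{\mathcal R}=I-P_{\mathcal R}$, is reducing for $\Sigma$ if $\Sigma=P_{\mathcal R}\Sigma P_{\mathcal R}+Q_{\mathcal R}\Sigma Q_{\mathcal R}$. The $\Sigma$-envelope of $f$ is the intersection of all reducing subspaces of $\Sigma$ that contain $f(x)$ for every $x\in D$. Let $\Gamma\in\mathbb R^{r\times u}$ be a matrix whose columns form an orthonormal basis of the $\Sigma$-envelope of $f$, and let $\Omega=\Gamma^T\Sigma\Gamma$,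 the covariance matrix of $\Gamma^T\varepsilon$. Both $\Gamma$ and $\Omega$ are known. Assume $\mathbb E[y_j^2]<\infty$ for $j=1,\dots,r$. Let $(x_1,y_1),(x_2,y_2),\dots$ be i.i.d. copies of $(x,y)$. For $\lambda_n>0$ the kernel envelope (KENV) estimate $\hat g_n=(\hat g_{n,1},\dots,\hat g_{n,u})$ from the first $n$ observations maximizes, over $g=(g_1,\dots,g_u)\in\mathcal H_K^u$, $$-\frac n2\log|\Omega|-\frac12\sum_{i=1}^n(\Gamma^Ty_i-g(x_i))^T\Omega^{-1}(\Gamma^Ty_i-g(x_i))-\frac{\lambda_n}{2}\sum_{k=1}^u\Big\|\sum_{j=1}^u[\Omega^{-1/2}]_{kj}\,g_j\Big\|_{\mathcal H_K}^2 .$$ Suppose that $\lambda_n/n\to0$ and $\lambda_n/n^{3/4}\to\infty$ as $n\to\infty$. Then the KENV estimate is risk consistent, both for the standardized material response and for the whole response; that is, with $(x,y)$ independent of the sample and with all the risks and optimal risks below finite (almost surely, for those of the estimates), as $n\to\infty$: 1. $R(\hat g_n)\to R^*$ in probability, where $R(g)=\mathbb E\big[(\Gamma^Ty-g(x))^T\Omega^{-1}(\Gamma^Ty-g(x))\big]=\mathbb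 E\big\|\Omega^{-1/2}\Gamma^Ty-\Omega^{-1/2}g(x)\big\|_2^2$ and $R^*=\inf\{R(g): g:\mathbb R^p\to\mathbb R^u \text{ measurable}\}$; 2. $R_{\mathrm{sq}}(\Gamma\hat g_n)\to R_{\mathrm{sq}}^*$ in probability, where $R_{\mathrm{sq}}(h)=\mathbb E\|y-h(x)\|_2^2$ and $R_{\mathrm{sq}}^*=\inf\{R_{\mathrm{sq}}(h): h:\mathbb R^p\to\mathbb R^r\text{ measurable}\}$. Here the risk of an estimate is the expectation over $(x,y)$ with the sample held fixed. -/

import Mathlib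

open MeasureTheory ProbabilityTheory Filter Topology
open scoped ENNReal MatrixOrder

noncomputable section

namespace KENV

/-! ### Envelopes -/

/-- A subspace `R` of `ℝ^r` is a reducing subspace of the matrix `M` if
`M = P_R M P_R + Q_R M Q_R`, where `P_R` is the orthogonal projection onto `R` and
`Q_R = I - P_R` is the orthogonal projection onto its orthogonal complement. -/
def IsReducing {r : ℕ} (M : Matrix (Fin r) (Fin r) ℝ)
    (R : Submodule ℝ (EuclideanSpace ℝ (Fin r))) : Prop :=
  Matrix.toEuclideanCLM (n := Fin r) (𝕜 := ℝ) M =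
    R.starProjection * Matrix.toEuclideanCLM (n := Fin r) (𝕜 := ℝ) M * R.starProjection +
    (1 - R.starProjection) * Matrix.toEuclideanCLM (n := Fin r) (𝕜 := ℝ) M *
      (1 - R.starProjection)

/-- The `M`-envelope of a function `f` with domain `D`: the intersection of all reducing subspaces
of `M` that contain `f x` for every `x` in `D`. -/
def envelope {p r : ℕ} (M : Matrix (Fin r) (Fin r) ℝ)
    (f : EuclideanSpace ℝ (Fin p) → EuclideanSpace ℝ (Fin r))
    (D : Set (EuclideanSpace ℝ (Fin p))) : Submodule ℝ (EuclideanSpace ℝ (Fin r)) :=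
  sInf {R | IsReducing M R ∧ ∀ x ∈ D, f x ∈ R}

/-- `Γ` is an orthogonal basis matrix of the subspace `E`: its columns are orthonormal and
span `E`. -/
def IsBasisMatrix {r u : ℕ} (Γ : Matrix (Fin r) (Fin u) ℝ)
    (E : Submodule ℝ (EuclideanSpace ℝ (Fin r))) : Prop :=
  Γ.transpose * Γ = 1 ∧
    Submodule.span ℝ (Set.range fun j : Fin u => WithLp.toLp 2 (fun i => Γ i j)) = E

/-- The error `ε = y - f(x)`, as a random vector on the space of pairs `(x, y)`. -/
def error {p r : ℕ} {𝒳 : Set (EuclideanSpace ℝ (Fin p))}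
    (f : EuclideanSpace ℝ (Fin p) → EuclideanSpace ℝ (Fin r))
    (z : 𝒳 × EuclideanSpace ℝ (Fin r)) : EuclideanSpace ℝ (Fin r) :=
  z.2 - f z.1

/-- The nonparametric response envelope model for the joint law `μ` of `(x, y)`, where `x` takes
values in `𝒳`: `y = f(x) + ε` with `f` measurable, `ε` independent of `x`, of mean zero and with
positive definite covariance matrix `Sig`; and `Γ` is an orthogonal basis matrix of the
`Sig`-envelope of `f` (on the domain `D` of `f`). -/
structure IsEnvelopeModel {p r u : ℕ} {𝒳 : Set (EuclideanSpace ℝ (Fin p))}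
    (μ : Measure (𝒳 × EuclideanSpace ℝ (Fin r)))
    (D : Set (EuclideanSpace ℝ (Fin p)))
    (f : EuclideanSpace ℝ (Fin p) → EuclideanSpace ℝ (Fin r))
    (Sig : Matrix (Fin r) (Fin r) ℝ) (Γ : Matrix (Fin r) (Fin u) ℝ) : Prop where
  subset_domain : 𝒳 ⊆ D
  measurable_regression : Measurable f
  indep : IndepFun (error f) (fun z : 𝒳 × EuclideanSpace ℝ (Fin r) => z.1) μ
  memLp_error : MemLp (error (𝒳 := 𝒳) f) 2 μ
  mean_error : ∫ z, error f z ∂μ = 0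
  cov_error : ∀ i j, cov[fun z => error f z i, fun z => error f z j; μ] = Sig i j
  posDef : Sig.PosDef
  basis : IsBasisMatrix Γ (envelope Sig f D)

/-- The covariance matrix `Ω = Γᵀ Sig Γ` of the material part `Γᵀ ε` of the error. -/
def materialCov {r u : ℕ} (Sig : Matrix (Fin r) (Fin r) ℝ) (Γ : Matrix (Fin r) (Fin u) ℝ) :
    Matrix (Fin u) (Fin u) ℝ :=
  Γ.transpose * Sig * Γ

/-! ### Universal kernels -/

/-- The real-valued reproducing kernel `K(x, x')` of a reproducing kernel Hilbert space `H` of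
real functions on `X`. -/
def kernelFun {X : Type*} (H : Type*) [NormedAddCommGroup H] [InnerProductSpace ℝ H]
    [CompleteSpace H] [RKHS ℝ H X ℝ] (x x' : X) : ℝ :=
  RKHS.kernel H x x' 1

/-- The kernel of `H` is universal: it is continuous, and `H` is dense in the continuous functions
on `X` for the supremum norm. -/
def IsUniversal {X : Type*} [TopologicalSpace X] (H : Type*) [NormedAddCommGroup H]
    [InnerProductSpace ℝ H] [CompleteSpace H] [RKHS ℝ H X ℝ] : Prop :=
  Continuous (fun q : X × X => kernelFun H q.1 q.2) ∧
    ∀ φ : C(X, ℝ), ∀ δ : ℝ, 0 < δ → ∃ h : H, ∀ x, |h x - φ x| < δ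

/-! ### The kernel envelope estimator with known `Γ` and `Ω` -/

/-- The function `x ↦ (g₁(x), …, g_u(x))` given by a tuple of elements of `H`. -/
def evalVec {X : Type*} {H : Type*} [NormedAddCommGroup H] [InnerProductSpace ℝ H]
    [RKHS ℝ H X ℝ] {u : ℕ} (g : Fin u → H) (x : X) : EuclideanSpace ℝ (Fin u) :=
  WithLp.toLp 2 fun j => g j x

/-- The vector `Γᵀ y`. -/
def material {r u : ℕ} (Γ : Matrix (Fin r) (Fin u) ℝ) (y : EuclideanSpace ℝ (Fin r)) :
    EuclideanSpace ℝ (Fin u) :=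
  WithLp.toLp 2 (Matrix.mulVec Γ.transpose y.ofLp)

/-- The vector `Γ v`. -/
def embed {r u : ℕ} (Γ : Matrix (Fin r) (Fin u) ℝ) (v : EuclideanSpace ℝ (Fin u)) :
    EuclideanSpace ℝ (Fin r) :=
  WithLp.toLp 2 (Matrix.mulVec Γ v.ofLp)

/-- The quadratic form `vᵀ Ω⁻¹ v = ‖Ω^{-1/2} v‖²`. -/
def quadInv {u : ℕ} (Ω : Matrix (Fin u) (Fin u) ℝ) (v : EuclideanSpace ℝ (Fin u)) : ℝ :=
  dotProduct v.ofLp (Matrix.mulVec Ω⁻¹ v.ofLp)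

/-- The part of the normal log-likelihood that involves the material part of the response:
`-(n/2) log |Ω| - (1/2) ∑ᵢ (Γᵀ yᵢ - g(xᵢ))ᵀ Ω⁻¹ (Γᵀ yᵢ - g(xᵢ))`. -/
def materialLogLik {X : Type*} {H : Type*} [NormedAddCommGroup H] [InnerProductSpace ℝ H]
    [RKHS ℝ H X ℝ] {r u n : ℕ} (Γ : Matrix (Fin r) (Fin u) ℝ) (Ω : Matrix (Fin u) (Fin u) ℝ)
    (data : Fin n → X × EuclideanSpace ℝ (Fin r)) (g : Fin u → H) : ℝ :=
  -((n : ℝ) / 2) * Real.log Ω.det -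
    (1 / 2) * ∑ i, quadInv Ω (material Γ (data i).2 - evalVec g (data i).1)

/-- The penalty `ρ(g, Ω) = ρ(Ω^{-1/2} g) = ∑ᵢ ‖∑ⱼ [Ω^{-1/2}]ᵢⱼ gⱼ‖²_H`, where `Ω^{-1/2}` is the
inverse of the positive semidefinite square root of `Ω`. -/
def penalty {H : Type*} [NormedAddCommGroup H] [InnerProductSpace ℝ H] {u : ℕ}
    (Ω : Matrix (Fin u) (Fin u) ℝ) (g : Fin u → H) : ℝ :=
  ∑ i, ‖∑ j, (CFC.sqrt Ω)⁻¹ i j • g j‖ ^ 2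

/-- `g` is a solution of the kernel envelope estimation problem for the given data, with known
`Γ` and `Ω` and penalty parameter `lam`: it maximizes the penalized log-likelihood over all tuples
of elements of `H`. -/
def IsKENVSolution {X : Type*} {H : Type*} [NormedAddCommGroup H] [InnerProductSpace ℝ H]
    [RKHS ℝ H X ℝ] {r u n : ℕ} (Γ : Matrix (Fin r) (Fin u) ℝ) (Ω : Matrix (Fin u) (Fin u) ℝ)
    (lam : ℝ) (data : Fin n → X × EuclideanSpace ℝ (Fin r)) (g : Fin u → H) : Prop :=
  IsMaxOn (fun g' : Fin u → H => materialLogLik Γ Ω data g' - lam / 2 * penalty Ω g') Set.univ g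

/-! ### Risk -/

/-- The risk `R(g) = E[L(y, g(x))]` of a function `g` on `𝒳` for a nonnegative loss `L`, where
`(x, y)` has law `μ`. It is `∞` when the expectation is infinite. -/
def risk {p r k : ℕ} {𝒳 : Set (EuclideanSpace ℝ (Fin p))}
    (μ : Measure (𝒳 × EuclideanSpace ℝ (Fin r)))
    (L : EuclideanSpace ℝ (Fin r) → EuclideanSpace ℝ (Fin k) → ℝ)
    (g : 𝒳 → EuclideanSpace ℝ (Fin k)) : ℝ≥0∞ :=
  ∫⁻ z, ENNReal.ofReal (L z.2 (g z.1)) ∂μ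

/-- The optimal risk `R*`: the infimum of the risk over all measurable functions on `ℝ^p`. -/
def optimalRisk {p r : ℕ} (k : ℕ) {𝒳 : Set (EuclideanSpace ℝ (Fin p))}
    (μ : Measure (𝒳 × EuclideanSpace ℝ (Fin r)))
    (L : EuclideanSpace ℝ (Fin r) → EuclideanSpace ℝ (Fin k) → ℝ) : ℝ≥0∞ :=
  ⨅ (g : EuclideanSpace ℝ (Fin p) → EuclideanSpace ℝ (Fin k)) (_ : Measurable g),
    risk μ L (fun x : 𝒳 => g x)

/-- Risk consistency of a sequence of random functions `ghat n ω : 𝒳 → ℝ^k`: the optimal risk is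
finite, the risks of the estimates are almost surely finite, and they converge in probability to
the optimal risk. -/
def IsRiskConsistent {p r k : ℕ} {𝒳 : Set (EuclideanSpace ℝ (Fin p))}
    {S : Type*} [MeasurableSpace S] (P : Measure S)
    (μ : Measure (𝒳 × EuclideanSpace ℝ (Fin r)))
    (L : EuclideanSpace ℝ (Fin r) → EuclideanSpace ℝ (Fin k) → ℝ)
    (ghat : ℕ → S → 𝒳 → EuclideanSpace ℝ (Fin k)) : Prop :=
  optimalRisk k μ L ≠ ∞ ∧
    (∀ n, ∀ᵐ ω ∂P, risk μ L (ghat n ω) ≠ ∞) ∧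
    TendstoInMeasure P (fun n ω => (risk μ L (ghat n ω)).toReal) atTop
      (fun _ => (optimalRisk k μ L).toReal)

/-- The loss `(Γᵀ y - v)ᵀ Ω⁻¹ (Γᵀ y - v) = ‖Ω^{-1/2} Γᵀ y - Ω^{-1/2} v‖²`: the squared error for
the standardized material response. -/
def standardizedLoss {r u : ℕ} (Γ : Matrix (Fin r) (Fin u) ℝ) (Ω : Matrix (Fin u) (Fin u) ℝ)
    (y : EuclideanSpace ℝ (Fin r)) (v : EuclideanSpace ℝ (Fin u)) : ℝ :=
  quadInv Ω (material Γ y - v)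

/-- The squared error loss `‖y - w‖²` for the whole response. -/
def squaredLoss {r : ℕ} (y w : EuclideanSpace ℝ (Fin r)) : ℝ :=
  ‖y - w‖ ^ 2

end KENV

end

/-! In the standardized tuple `h = Ω^{-1/2} g` the penalty is the sum of the squared RKHS norms of
the entries, so the objective splits into `u` separate kernel ridge regressions (`penalized_eq`).
The `k`-th one regresses the `k`-th coordinate of `Ω^{-1/2} Γᵀ y` on the features `Φ(x) = K(x, ·)`.
Its regression function `m` is the `k`-th coordinate of `Ω^{-1/2} Γᵀ f`, and a maximizer satisfies
its normal equations (`IsKENVSolution.normal_eq`).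

Consistency of a single ridge regression (`tendstoInMeasure_ridge`) is proved by comparing the
empirical solution with the population solution `h₀` for the penalty `c = λ/n`. The bias of `h₀`
vanishes because universality makes the RKHS dense in `L²` and `c → 0` (`tendsto_ridge_bias`). For
the deviation, strong convexity gives `λ‖h - h₀‖ ≤ ‖∑ ζᵢ‖` with `ζᵢ` i.i.d. and centred in `H`. The
second moment of the sum is at most `nV` with `V` independent of `n`, so Chebyshev bounds the
probability of a deviation `δ` by `nV/(λδ)²`. The growth of `λ` enters only through `λ²/n → ∞`.

Since `ε` is centred and independent of `x`, each risk is a constant plus the mean square distance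
to the regression function, and the constant is the optimal risk (`risk_eq`, `optimalRisk_eq`). For
the whole response, `f` takes values in the envelope, so `f - Γg = Γ Ω^{1/2} · Ω^{-1/2}(Γᵀf - g)`,
and the second claim follows from the same convergence through an operator norm bound. -/

namespace KENV

open scoped RealInnerProductSpace

/-! ### Ridge regression in a Hilbert space: bias, deviation, consistency -/

section RidgeRegression

variable {α : Type*} [MeasurableSpace α] {μ : Measure α}
  {H : Type*} [NormedAddCommGroup H] [InnerProductSpace ℝ H]

theorem integrable_inner_of_memLp_two {f g : α → H} (hf : MemLp f 2 μ) (hg : MemLp g 2 μ) :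
    Integrable (fun z => ⟪f z, g z⟫) μ :=
  (hf.norm.integrable_mul hg.norm).mono' (hf.1.inner hg.1)
    (Eventually.of_forall fun z => norm_inner_le_norm (f z) (g z))

theorem memLp_two_smul_of_bounded {w : α → ℝ} {Φ : α → H} {κ : ℝ}
    (hw : MemLp w 2 μ) (hΦ : AEStronglyMeasurable Φ μ) (hκ : ∀ z, ‖Φ z‖ ≤ κ) :
    MemLp (fun z => w z • Φ z) 2 μ := by
  refine (hw.const_mul κ).mono (hw.1.smul hΦ) (Eventually.of_forall fun z => ?_)
  rw [norm_smul, norm_mul, mul_comm]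
  gcongr
  exact (hκ z).trans (le_abs_self κ)

theorem memLp_inner_const_of_bounded [IsFiniteMeasure μ] {Φ : α → H} {κ : ℝ}
    (hΦ : AEStronglyMeasurable Φ μ) (hκ : ∀ z, ‖Φ z‖ ≤ κ) (h : H) :
    MemLp (fun z => ⟪Φ z, h⟫) 2 μ :=
  (MemLp.of_bound hΦ κ (Eventually.of_forall hκ)).inner_const h

/-- The normal equations of the population ridge regression of `m` on the features `Φ` have a
solution. -/
theorem exists_ridge_solution [CompleteSpace H] [IsFiniteMeasure μ] {m : α → ℝ} {Φ : α → H} {κ c : ℝ}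
    (hm : MemLp m 2 μ) (hΦ : AEStronglyMeasurable Φ μ) (hκ : ∀ z, ‖Φ z‖ ≤ κ) (hc : 0 < c) :
    ∃ h₀ : H, ∀ η : H, ∫ z, (m z - ⟪Φ z, h₀⟫) * ⟪Φ z, η⟫ ∂μ = c * ⟪h₀, η⟫ := by
  have hmΦ : Integrable (fun z => m z • Φ z) μ :=
    (memLp_two_smul_of_bounded hm hΦ hκ).integrable one_le_two
  have hT : Integrable (fun z => InnerProductSpace.rankOne ℝ (Φ z) (Φ z)) μ := by
    refine Integrable.of_bound (C := κ * κ) ?_ (Eventually.of_forall fun z => ?_)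
    · exact Continuous.comp_aestronglyMeasurable
        (g := fun v : H => InnerProductSpace.rankOne ℝ v v)
        (by simp_rw [InnerProductSpace.rankOne_def]; fun_prop) hΦ
    · rw [InnerProductSpace.norm_rankOne]
      exact mul_le_mul (hκ z) (hκ z) (norm_nonneg _) ((norm_nonneg _).trans (hκ z))
  -- Lax–Milgram: `B` is the form of the operator `E[Φ ⊗ Φ] + c`, coercive with constant `c`, and
  -- the normal equations say that `B h₀` is the functional represented by `E[m Φ]`.
  let B : H →L[ℝ] H →L[ℝ] ℝ :=
    (isBoundedBilinearMap_inner (𝕜 := ℝ) (E := H)).toContinuousLinearMap ∘L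
      ((∫ z, InnerProductSpace.rankOne ℝ (Φ z) (Φ z) ∂μ) + c • ContinuousLinearMap.id ℝ H)
  have hB : ∀ g η, B g η = ∫ z, ⟪Φ z, g⟫ * ⟪Φ z, η⟫ ∂μ + c * ⟪g, η⟫ := by
    intro g η
    have h1 : B g η = ⟪(∫ z, InnerProductSpace.rankOne ℝ (Φ z) (Φ z) ∂μ) g + c • g, η⟫ := rfl
    rw [h1, ContinuousLinearMap.integral_apply hT, inner_add_left, real_inner_smul_left,
      real_inner_comm, ← integral_inner (hT.apply_continuousLinearMap g)]
    simp [inner_smul_right, real_inner_comm]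
  have hcoer : IsCoercive B := by
    refine ⟨c, hc, fun g => ?_⟩
    rw [hB, real_inner_self_eq_norm_mul_norm, mul_assoc]
    exact le_add_of_nonneg_left (integral_nonneg fun z => mul_self_nonneg _)
  refine ⟨(hcoer.continuousLinearEquivOfBilin).symm (∫ z, m z • Φ z ∂μ), fun η => ?_⟩
  set h₀ := (hcoer.continuousLinearEquivOfBilin).symm (∫ z, m z • Φ z ∂μ)
  have h1 := hcoer.continuousLinearEquivOfBilin_apply h₀ η
  rw [ContinuousLinearEquiv.apply_symm_apply, hB, real_inner_comm, ← integral_inner hmΦ] at h1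
  simp_rw [sub_mul]
  rw [integral_sub]
  · simp_rw [inner_smul_right, real_inner_comm (Φ _) η] at h1
    linarith
  · exact hm.integrable_mul (memLp_inner_const_of_bounded hΦ hκ η)
  · exact (memLp_inner_const_of_bounded hΦ hκ h₀).integrable_mul
      (memLp_inner_const_of_bounded hΦ hκ η)

/-- Expanding the objective around `h₀`, the normal equations cancel the terms linear in `h - h₀`,
and the remaining quadratic terms are nonnegative. It serves with `h` an approximant of `m`, for the
bias, and with `h = 0`, for a variance bound uniform in `c`. -/
theorem ridge_objective_le [IsFiniteMeasure μ] {m : α → ℝ} {Φ : α → H} {κ c : ℝ}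
    (hm : MemLp m 2 μ) (hΦ : AEStronglyMeasurable Φ μ) (hκ : ∀ z, ‖Φ z‖ ≤ κ) (hc : 0 ≤ c)
    {h₀ : H} (h₀_eq : ∀ η : H, ∫ z, (m z - ⟪Φ z, h₀⟫) * ⟪Φ z, η⟫ ∂μ = c * ⟪h₀, η⟫) (h : H) :
    ∫ z, (m z - ⟪Φ z, h₀⟫) ^ 2 ∂μ + c * ‖h₀‖ ^ 2 ≤
      ∫ z, (m z - ⟪Φ z, h⟫) ^ 2 ∂μ + c * ‖h‖ ^ 2 := by
  have hr : MemLp (fun z => m z - ⟪Φ z, h₀⟫) 2 μ :=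
    hm.sub (memLp_inner_const_of_bounded hΦ hκ h₀)
  have hd := memLp_inner_const_of_bounded hΦ hκ (h - h₀)
  have hrd : Integrable (fun z => (m z - ⟪Φ z, h₀⟫) * ⟪Φ z, h - h₀⟫) μ := hr.integrable_mul hd
  have hexp : ∫ z, (m z - ⟪Φ z, h⟫) ^ 2 ∂μ = ∫ z, (m z - ⟪Φ z, h₀⟫) ^ 2 ∂μ
      - 2 * (c * ⟪h₀, h - h₀⟫) + ∫ z, ⟪Φ z, h - h₀⟫ ^ 2 ∂μ := by
    have hsub : Integrable
        (fun z => (m z - ⟪Φ z, h₀⟫) ^ 2 - 2 * ((m z - ⟪Φ z, h₀⟫) * ⟪Φ z, h - h₀⟫)) μ :=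
      hr.integrable_sq.sub (hrd.const_mul 2)
    rw [← h₀_eq, ← integral_const_mul, ← integral_sub hr.integrable_sq (hrd.const_mul 2),
      ← integral_add hsub hd.integrable_sq]
    refine integral_congr_ae (Eventually.of_forall fun z => ?_)
    simp only [inner_sub_right]
    ring
  have hpos : 0 ≤ ∫ z, ⟪Φ z, h - h₀⟫ ^ 2 ∂μ := integral_nonneg fun z => sq_nonneg _
  have hn : ‖h‖ ^ 2 = ‖h₀‖ ^ 2 + 2 * ⟪h₀, h - h₀⟫ + ‖h - h₀‖ ^ 2 := by
    rw [← norm_add_sq_real, add_sub_cancel]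
  rw [hexp, hn]
  nlinarith [mul_nonneg hc (sq_nonneg ‖h - h₀‖)]

/-- A sum of `n` independent centred random vectors with common law has second moment `n` times
that of one of them. -/
theorem integral_norm_sq_sum_of_iIndepFun [CompleteSpace H]
    {S : Type*} [MeasurableSpace S] {P : Measure S} [IsProbabilityMeasure P]
    {Z : ℕ → S → α} (hZ_law : ∀ i, HasLaw (Z i) μ P) (hZ_indep : iIndepFun Z P)
    {ζ : α → H} (hζ : MemLp ζ 2 μ) (hζ0 : ∫ z, ζ z ∂μ = 0) (n : ℕ) :
    MemLp (fun ω => ∑ i : Fin n, ζ (Z i ω)) 2 P ∧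
      ∫ ω, ‖∑ i : Fin n, ζ (Z i ω)‖ ^ 2 ∂P = n * ∫ z, ‖ζ z‖ ^ 2 ∂μ := by
  have hmem : ∀ i, MemLp (fun ω => ζ (Z i ω)) 2 P := fun i => by
    have := hζ
    rw [← (hZ_law i).map_eq] at this
    exact this.comp_of_map (hZ_law i).aemeasurable
  have := (hZ_law 0).isProbabilityMeasure_iff.1 inferInstance
  have hint : ∀ i, Integrable ζ (P.map (Z i)) := fun i => by
    rw [(hZ_law i).map_eq]; exact hζ.integrable one_le_two
  have hmean : ∀ i, ∫ ω, ζ (Z i ω) ∂P = 0 := fun i => by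
    rw [← hζ0]; exact (hZ_law i).integral_comp hζ.1
  refine ⟨memLp_finsetSum _ fun i _ => hmem i, ?_⟩
  simp_rw [← real_inner_self_eq_norm_sq, sum_inner, inner_sum]
  have hii : ∀ i j : Fin n, Integrable (fun ω => ⟪ζ (Z i ω), ζ (Z j ω)⟫) P := fun i j =>
    integrable_inner_of_memLp_two (hmem i) (hmem j)
  rw [integral_finsetSum _ fun i _ => integrable_finsetSum _ fun j _ => hii i j]
  have hinner : ∀ i : Fin n, ∫ ω, ∑ j : Fin n, ⟪ζ (Z i ω), ζ (Z j ω)⟫ ∂P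
      = ∫ z, ⟪ζ z, ζ z⟫ ∂μ := by
    intro i
    rw [integral_finsetSum _ fun j _ => hii i j, Finset.sum_eq_single i]
    · exact (hZ_law i).integral_comp (f := fun z => ⟪ζ z, ζ z⟫) (hζ.1.inner hζ.1)
    -- Off-diagonal terms vanish: independence factors the expected inner product into the inner
    -- product of two zero means.
    · intro j _ hj
      have hind := hZ_indep.indepFun (i := (i : ℕ)) (j := j)
        (fun h => hj (Fin.ext h.symm))
      have := hind.integral_bilin_comp_comp (hZ_law i).aemeasurable
        (hZ_law j).aemeasurable (hint i) (hint j)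
        (isBoundedBilinearMap_inner (𝕜 := ℝ) (E := H)).toContinuousLinearMap
      simpa [hmean, IsBoundedBilinearMap.toContinuousLinearMap_apply] using this
    · simp
  simp [hinner]

theorem integral_norm_sub_integral_sq_le [CompleteSpace H] [IsProbabilityMeasure μ] {ξ : α → H}
    (hξ : MemLp ξ 2 μ) :
    ∫ z, ‖ξ z - ∫ z', ξ z' ∂μ‖ ^ 2 ∂μ ≤ ∫ z, ‖ξ z‖ ^ 2 ∂μ := by
  set a := ∫ z', ξ z' ∂μ
  have h1 := hξ.integrable one_le_two
  have hsq : Integrable (fun z => ‖ξ z‖ ^ 2) μ := (memLp_two_iff_integrable_sq_norm hξ.1).1 hξ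
  have hin : Integrable (fun z => 2 * ⟪a, ξ z⟫) μ := (h1.const_inner a).const_mul 2
  have hsub : Integrable (fun z => ‖ξ z‖ ^ 2 - 2 * ⟪a, ξ z⟫) μ := hsq.sub hin
  have : ∫ z, ‖ξ z - a‖ ^ 2 ∂μ = ∫ z, ‖ξ z‖ ^ 2 ∂μ - ‖a‖ ^ 2 := by
    simp_rw [norm_sub_sq_real, real_inner_comm a]
    rw [integral_add hsub (integrable_const _), integral_sub hsq hin, integral_const_mul,
      integral_inner h1, real_inner_self_eq_norm_sq]
    simp
    ring
  rw [this]
  exact sub_le_self _ (sq_nonneg _)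

/-- The distance of an empirical ridge solution to any `h₀` is controlled by the norm of the
empirical normal equations at `h₀`. -/
theorem mul_norm_sub_le_of_normal_eq {n : ℕ} {Φ : Fin n → H} {w : Fin n → ℝ} {c : ℝ} {h h₀ : H}
    (h_eq : ∀ η : H, ∑ i, (w i - ⟪Φ i, h⟫) * ⟪Φ i, η⟫ = n * c * ⟪h, η⟫) :
    n * c * ‖h - h₀‖ ≤ ‖∑ i, ((w i - ⟪Φ i, h₀⟫) • Φ i - c • h₀)‖ := by
  -- Strong monotonicity of the gradient: testing the normal equations against `h - h₀` leaves `n c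
  -- ‖h - h₀‖²` plus a nonnegative sum. Cauchy–Schwarz then allows one factor `‖h - h₀‖` to be
  -- cancelled.
  have key : ⟪∑ i, ((w i - ⟪Φ i, h₀⟫) • Φ i - c • h₀), h - h₀⟫
      = ∑ i, ⟪Φ i, h - h₀⟫ ^ 2 + n * c * ‖h - h₀‖ ^ 2 := by
    have h1 : ∑ i, (w i - ⟪Φ i, h₀⟫) * ⟪Φ i, h - h₀⟫
        = ∑ i, (w i - ⟪Φ i, h⟫) * ⟪Φ i, h - h₀⟫ + ∑ i, ⟪Φ i, h - h₀⟫ ^ 2 := by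
      rw [← Finset.sum_add_distrib]
      refine Finset.sum_congr rfl fun i _ => ?_
      simp only [inner_sub_right]
      ring
    simp_rw [sum_inner, inner_sub_left (_ • _), real_inner_smul_left]
    rw [Finset.sum_sub_distrib, h1, h_eq, ← real_inner_self_eq_norm_sq, inner_sub_left]
    simp
    ring
  have hle := real_inner_le_norm (∑ i, ((w i - ⟪Φ i, h₀⟫) • Φ i - c • h₀)) (h - h₀)
  have hpos : 0 ≤ ∑ i, ⟪Φ i, h - h₀⟫ ^ 2 := Finset.sum_nonneg fun i _ => sq_nonneg _
  rcases (norm_nonneg (h - h₀)).eq_or_lt with h0 | h0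
  · rw [← h0, mul_zero]
    exact norm_nonneg _
  · refine le_of_mul_le_mul_right ?_ h0
    nlinarith

/-- Fix an approximant `h` of `m`. By minimality the bias at `n` is at most the error of `h` plus `c
n * ‖h‖ ^ 2`, whose second term vanishes as `c n → 0`. -/
theorem tendsto_ridge_bias [IsFiniteMeasure μ] {m : α → ℝ} {Φ : α → H} {κ : ℝ}
    (hm : MemLp m 2 μ) (hΦ : AEStronglyMeasurable Φ μ) (hκ : ∀ z, ‖Φ z‖ ≤ κ)
    (happrox : ∀ δ : ℝ, 0 < δ → ∃ h : H, ∫ z, (m z - ⟪Φ z, h⟫) ^ 2 ∂μ < δ)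
    {c : ℕ → ℝ} (hc : ∀ᶠ n in atTop, 0 ≤ c n) (hc0 : Tendsto c atTop (𝓝 0)) {h₀ : ℕ → H}
    (h₀_eq : ∀ᶠ n in atTop, ∀ η : H,
      ∫ z, (m z - ⟪Φ z, h₀ n⟫) * ⟪Φ z, η⟫ ∂μ = c n * ⟪h₀ n, η⟫) :
    Tendsto (fun n => ∫ z, (m z - ⟪Φ z, h₀ n⟫) ^ 2 ∂μ) atTop (𝓝 0) := by
  refine tendsto_order.2 ⟨fun a ha => Eventually.of_forall fun n =>
    ha.trans_le (integral_nonneg fun z => sq_nonneg _), fun a ha => ?_⟩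
  obtain ⟨h, hh⟩ := happrox a ha
  have hlim : Tendsto (fun n => ∫ z, (m z - ⟪Φ z, h⟫) ^ 2 ∂μ + c n * ‖h‖ ^ 2) atTop
      (𝓝 (∫ z, (m z - ⟪Φ z, h⟫) ^ 2 ∂μ + 0 * ‖h‖ ^ 2)) :=
    (hc0.mul_const _).const_add _
  rw [zero_mul, add_zero] at hlim
  filter_upwards [hlim.eventually (gt_mem_nhds hh), hc, h₀_eq] with n hn hcn hn0
  have := ridge_objective_le hm hΦ hκ hcn hn0 h
  nlinarith [mul_nonneg hcn (sq_nonneg ‖h₀ n‖)]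

/-- Chebyshev bound for the deviation of an empirical ridge solution from the population ridge
solution. -/
theorem measure_ridge_deviation_le [CompleteSpace H] [IsProbabilityMeasure μ]
    {m w : α → ℝ} {Φ : α → H} {κ c : ℝ}
    (hw : MemLp w 2 μ) (hm : MemLp m 2 μ) (hΦ : AEStronglyMeasurable Φ μ) (hκ : ∀ z, ‖Φ z‖ ≤ κ)
    (hwm : ∀ η : H, ∫ z, (w z - m z) * ⟪Φ z, η⟫ ∂μ = 0) (hc : 0 < c) {h₀ : H}
    (h₀_eq : ∀ η : H, ∫ z, (m z - ⟪Φ z, h₀⟫) * ⟪Φ z, η⟫ ∂μ = c * ⟪h₀, η⟫)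
    {S : Type*} [MeasurableSpace S] {P : Measure S} [IsProbabilityMeasure P]
    {Z : ℕ → S → α} (hZ_law : ∀ i, HasLaw (Z i) μ P) (hZ_indep : iIndepFun Z P)
    {n : ℕ} (hn : 0 < n) {h : S → H}
    (h_eq : ∀ᵐ ω ∂P, ∀ η : H, ∑ i : Fin n, (w (Z i ω) - ⟪Φ (Z i ω), h ω⟫) * ⟪Φ (Z i ω), η⟫ =
      n * c * ⟪h ω, η⟫) {δ : ℝ} (hδ : 0 < δ) :
    P {ω | δ ≤ ‖h ω - h₀‖} ≤ ENNReal.ofReal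
      (n * (κ ^ 2 * (2 * ∫ z, (w z - m z) ^ 2 ∂μ + 2 * ∫ z, m z ^ 2 ∂μ)) / (n * c * δ) ^ 2) := by
  have hr₀ : MemLp (fun z => m z - ⟪Φ z, h₀⟫) 2 μ :=
    hm.sub (memLp_inner_const_of_bounded hΦ hκ h₀)
  have hr : MemLp (fun z => w z - ⟪Φ z, h₀⟫) 2 μ :=
    hw.sub (memLp_inner_const_of_bounded hΦ hκ h₀)
  have hwm2 : MemLp (fun z => w z - m z) 2 μ := hw.sub hm
  set ξ : α → H := fun z => (w z - ⟪Φ z, h₀⟫) • Φ z with hξdef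
  have hξ : MemLp ξ 2 μ := memLp_two_smul_of_bounded hr hΦ hκ
  have hξ1 := hξ.integrable one_le_two
  -- The population normal equations identify the mean of `ξ`; replacing `m` by the noisy response
  -- `w` costs nothing because `w - m` is orthogonal to the features.
  have hξmean : ∫ z, ξ z ∂μ = c • h₀ := by
    refine ext_inner_left ℝ fun η => ?_
    have i1 : Integrable (fun z => (w z - m z) * ⟪Φ z, η⟫) μ :=
      hwm2.integrable_mul (memLp_inner_const_of_bounded hΦ hκ η)
    have i2 : Integrable (fun z => (m z - ⟪Φ z, h₀⟫) * ⟪Φ z, η⟫) μ :=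
      hr₀.integrable_mul (memLp_inner_const_of_bounded hΦ hκ η)
    rw [← integral_inner hξ1, real_inner_smul_right, real_inner_comm, ← h₀_eq, ← zero_add
      (∫ z, (m z - ⟪Φ z, h₀⟫) * ⟪Φ z, η⟫ ∂μ), ← hwm η, ← integral_add i1 i2]
    refine integral_congr_ae (Eventually.of_forall fun z => ?_)
    simp only [hξdef, real_inner_smul_right, real_inner_comm (Φ z) η]
    ring
  have hζ : MemLp (fun z => ξ z - c • h₀) 2 μ := hξ.sub (memLp_const _)
  have hζ0 : ∫ z, (ξ z - c • h₀) ∂μ = 0 := by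
    rw [integral_sub hξ1 (integrable_const _), hξmean]
    simp
  obtain ⟨hsum, hsum_eq⟩ := integral_norm_sq_sum_of_iIndepFun hZ_law hZ_indep hζ hζ0 n
  have hV : ∫ z, ‖ξ z - c • h₀‖ ^ 2 ∂μ ≤
      κ ^ 2 * (2 * ∫ z, (w z - m z) ^ 2 ∂μ + 2 * ∫ z, m z ^ 2 ∂μ) := by
    -- Comparison with the zero function keeps the variance bound independent of `c`, although
    -- `‖h₀‖` may grow as `c → 0`.
    have hbias : ∫ z, (m z - ⟪Φ z, h₀⟫) ^ 2 ∂μ ≤ ∫ z, m z ^ 2 ∂μ := by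
      have := ridge_objective_le hm hΦ hκ hc.le h₀_eq 0
      simp only [inner_zero_right, sub_zero, norm_zero] at this
      nlinarith [mul_nonneg hc.le (sq_nonneg ‖h₀‖)]
    rw [← hξmean]
    refine (integral_norm_sub_integral_sq_le hξ).trans ?_
    calc ∫ z, ‖ξ z‖ ^ 2 ∂μ
        ≤ ∫ z, κ ^ 2 * (2 * (w z - m z) ^ 2 + 2 * (m z - ⟪Φ z, h₀⟫) ^ 2) ∂μ := by
          refine integral_mono ((memLp_two_iff_integrable_sq_norm hξ.1).1 hξ)
            (((hwm2.integrable_sq.const_mul 2).add (hr₀.integrable_sq.const_mul 2)).const_mul _)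
            fun z => ?_
          have hk : ‖Φ z‖ ^ 2 ≤ κ ^ 2 := pow_le_pow_left₀ (norm_nonneg _) (hκ z) 2
          simp only [hξdef, norm_smul, mul_pow, Real.norm_eq_abs, sq_abs]
          rw [mul_comm]
          refine mul_le_mul hk ?_ (sq_nonneg _) (sq_nonneg _)
          nlinarith [sq_nonneg ((w z - m z) - (m z - ⟪Φ z, h₀⟫))]
      _ = κ ^ 2 * (2 * ∫ z, (w z - m z) ^ 2 ∂μ + 2 * ∫ z, (m z - ⟪Φ z, h₀⟫) ^ 2 ∂μ) := by
          rw [integral_const_mul, integral_add (hwm2.integrable_sq.const_mul 2)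
            (hr₀.integrable_sq.const_mul 2), integral_const_mul, integral_const_mul]
      _ ≤ _ := by gcongr
  have hpos : 0 < (n * c * δ) ^ 2 := by positivity
  have hmarkov := mul_meas_ge_le_integral_of_nonneg (μ := P)
    (f := fun ω => ‖∑ i : Fin n, (ξ (Z i ω) - c • h₀)‖ ^ 2)
    (Eventually.of_forall fun ω => sq_nonneg _)
    ((memLp_two_iff_integrable_sq_norm hsum.1).1 hsum) ((n * c * δ) ^ 2)
  rw [hsum_eq, ← le_div_iff₀' hpos] at hmarkov
  calc P {ω | δ ≤ ‖h ω - h₀‖}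
      ≤ P {ω | (n * c * δ) ^ 2 ≤ ‖∑ i : Fin n, (ξ (Z i ω) - c • h₀)‖ ^ 2} := by
        refine measure_mono_ae ?_
        filter_upwards [h_eq] with ω hω hωδ
        refine pow_le_pow_left₀ (by positivity) (le_trans ?_ (mul_norm_sub_le_of_normal_eq
          (Φ := fun i : Fin n => Φ (Z i ω)) (w := fun i : Fin n => w (Z i ω)) (h₀ := h₀) hω)) 2
        exact mul_le_mul_of_nonneg_left hωδ (by positivity)
    _ ≤ _ := by
        rw [← ofReal_measureReal]
        refine ENNReal.ofReal_le_ofReal (hmarkov.trans ?_)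
        gcongr

/-- Consistency of kernel ridge regression: the empirical ridge solutions converge in probability
to the regression function `m` in mean square, provided that `m` can be approximated by linear
functions of the features, `λₙ / n → 0` and `λₙ² / n → ∞`. -/
theorem tendstoInMeasure_ridge [CompleteSpace H] [IsProbabilityMeasure μ]
    {m w : α → ℝ} {Φ : α → H} {κ : ℝ}
    (hw : MemLp w 2 μ) (hm : MemLp m 2 μ) (hΦ : AEStronglyMeasurable Φ μ) (hκ : ∀ z, ‖Φ z‖ ≤ κ)
    (hwm : ∀ η : H, ∫ z, (w z - m z) * ⟪Φ z, η⟫ ∂μ = 0)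
    (happrox : ∀ δ : ℝ, 0 < δ → ∃ h : H, ∫ z, (m z - ⟪Φ z, h⟫) ^ 2 ∂μ < δ)
    {S : Type*} [MeasurableSpace S] {P : Measure S} [IsProbabilityMeasure P]
    {Z : ℕ → S → α} (hZ_law : ∀ i, HasLaw (Z i) μ P) (hZ_indep : iIndepFun Z P)
    {lam : ℕ → ℝ} (hlam_pos : ∀ n, 0 < lam n)
    (hlam_zero : Tendsto (fun n : ℕ => lam n / (n : ℝ)) atTop (𝓝 0))
    (hlam_top : Tendsto (fun n : ℕ => lam n ^ 2 / (n : ℝ)) atTop atTop)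
    {h : ℕ → S → H}
    (h_eq : ∀ n, ∀ᵐ ω ∂P, ∀ η : H,
      ∑ i : Fin n, (w (Z i ω) - ⟪Φ (Z i ω), h n ω⟫) * ⟪Φ (Z i ω), η⟫ = lam n * ⟪h n ω, η⟫) :
    TendstoInMeasure P (fun n ω => ∫ z, (m z - ⟪Φ z, h n ω⟫) ^ 2 ∂μ) atTop (fun _ => 0) := by
  have hc : ∀ n : ℕ, 0 < n → 0 < lam n / n := fun n hn =>
    div_pos (hlam_pos n) (Nat.cast_pos.2 hn)
  have hex : ∀ n : ℕ, ∃ h₀ : H, 0 < n → ∀ η : H,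
      ∫ z, (m z - ⟪Φ z, h₀⟫) * ⟪Φ z, η⟫ ∂μ = lam n / n * ⟪h₀, η⟫ := fun n => by
    rcases Nat.eq_zero_or_pos n with hn | hn
    · exact ⟨0, fun h => absurd h (by omega)⟩
    · obtain ⟨h₀, hh⟩ := exists_ridge_solution hm hΦ hκ (hc n hn)
      exact ⟨h₀, fun _ => hh⟩
  choose h₀ h₀_eq using hex
  have hbias := tendsto_ridge_bias hm hΦ hκ happrox
    ((eventually_gt_atTop 0).mono fun n hn => (hc n hn).le) hlam_zero
    ((eventually_gt_atTop 0).mono fun n hn => h₀_eq n hn)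
  rw [tendstoInMeasure_iff_norm]
  intro ε hε
  -- Once the bias is below `ε / 4`, an error of at least `ε` in the bound `2 * bias + 2 * κ² ‖h -
  -- h₀‖²` forces `‖h - h₀‖ ≥ δ`; the `+ 1` covers `κ = 0`.
  set δ : ℝ := √(ε / (4 * (κ ^ 2 + 1)))
  have hδ : 0 < δ := Real.sqrt_pos.2 (by positivity)
  have hδsq : δ ^ 2 = ε / (4 * (κ ^ 2 + 1)) := Real.sq_sqrt (by positivity)
  set V : ℝ := κ ^ 2 * (2 * ∫ z, (w z - m z) ^ 2 ∂μ + 2 * ∫ z, m z ^ 2 ∂μ)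
  have hlim : Tendsto (fun n : ℕ => ENNReal.ofReal (V / δ ^ 2 * (lam n ^ 2 / n)⁻¹)) atTop (𝓝 0) := by
    have := (tendsto_inv_atTop_zero.comp hlam_top).const_mul (V / δ ^ 2)
    rw [mul_zero] at this
    simpa using ENNReal.tendsto_ofReal this
  refine tendsto_of_tendsto_of_tendsto_of_le_of_le' tendsto_const_nhds hlim
    (Eventually.of_forall fun n => zero_le) ?_
  filter_upwards [eventually_gt_atTop 0, hbias.eventually (gt_mem_nhds (by positivity : 0 < ε / 4))]
    with n hn hbn
  have hn' : (0 : ℝ) < n := Nat.cast_pos.2 hn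
  have hnc : (n : ℝ) * (lam n / n) = lam n := mul_div_cancel₀ _ hn'.ne'
  have hdev := measure_ridge_deviation_le hw hm hΦ hκ hwm (hc n hn) (h₀_eq n hn) hZ_law hZ_indep hn
    (h := h n) (by rw [hnc]; exact h_eq n) hδ
  refine le_trans (measure_mono fun ω hω => ?_) (hdev.trans (ENNReal.ofReal_le_ofReal ?_))
  · simp only [Set.mem_ofPred_eq, sub_zero] at hω ⊢
    rw [Real.norm_of_nonneg (integral_nonneg fun z => sq_nonneg _)] at hω
    have hr₀ : MemLp (fun z => m z - ⟪Φ z, h₀ n⟫) 2 μ :=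
      hm.sub (memLp_inner_const_of_bounded hΦ hκ (h₀ n))
    have hr : MemLp (fun z => m z - ⟪Φ z, h n ω⟫) 2 μ :=
      hm.sub (memLp_inner_const_of_bounded hΦ hκ (h n ω))
    have hup : ∫ z, (m z - ⟪Φ z, h n ω⟫) ^ 2 ∂μ ≤
        2 * ∫ z, (m z - ⟪Φ z, h₀ n⟫) ^ 2 ∂μ + 2 * (κ ^ 2 * ‖h n ω - h₀ n‖ ^ 2) := by
      calc ∫ z, (m z - ⟪Φ z, h n ω⟫) ^ 2 ∂μ
          ≤ ∫ z, (2 * (m z - ⟪Φ z, h₀ n⟫) ^ 2 + 2 * (κ ^ 2 * ‖h n ω - h₀ n‖ ^ 2)) ∂μ := by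
            refine integral_mono hr.integrable_sq
              ((hr₀.integrable_sq.const_mul 2).add (integrable_const _)) fun z => ?_
            have h1 : ⟪Φ z, h n ω - h₀ n⟫ ^ 2 ≤ κ ^ 2 * ‖h n ω - h₀ n‖ ^ 2 := by
              rw [← mul_pow, ← sq_abs]
              exact pow_le_pow_left₀ (abs_nonneg _) ((abs_real_inner_le_norm _ _).trans
                (mul_le_mul_of_nonneg_right (hκ z) (norm_nonneg _))) 2
            rw [inner_sub_right] at h1
            nlinarith [sq_nonneg ((m z - ⟪Φ z, h₀ n⟫) + (⟪Φ z, h n ω⟫ - ⟪Φ z, h₀ n⟫))]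
        _ = _ := by
            rw [integral_add (hr₀.integrable_sq.const_mul 2) (integrable_const _),
              integral_const_mul]
            simp
    refine (pow_le_pow_iff_left₀ hδ.le (norm_nonneg _) two_ne_zero).1 ?_
    rw [hδsq, div_le_iff₀ (by positivity)]
    nlinarith [sq_nonneg ‖h n ω - h₀ n‖]
  · rw [hnc]
    have := (hlam_pos n).ne'
    change n * V / _ ≤ _
    clear_value V δ
    refine le_of_eq ?_
    field_simp

end RidgeRegression

/-! ### Matrices and the standardization by `Ω^{-1/2}` -/

section Matrices

/-- Multiplication by a matrix, as a continuous linear map between Euclidean spaces. -/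
noncomputable def mulVecCLM {k l : ℕ} (A : Matrix (Fin k) (Fin l) ℝ) :
    EuclideanSpace ℝ (Fin l) →L[ℝ] EuclideanSpace ℝ (Fin k) :=
  LinearMap.toContinuousLinearMap (Matrix.toEuclideanLin A)

theorem mulVecCLM_apply {k l : ℕ} (A : Matrix (Fin k) (Fin l) ℝ) (v : EuclideanSpace ℝ (Fin l)) :
    mulVecCLM A v = WithLp.toLp 2 (A.mulVec v.ofLp) := rfl

theorem mulVecCLM_mul {k l m : ℕ} (A : Matrix (Fin k) (Fin l) ℝ) (B : Matrix (Fin l) (Fin m) ℝ)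
    (v : EuclideanSpace ℝ (Fin m)) : mulVecCLM A (mulVecCLM B v) = mulVecCLM (A * B) v := by
  simp [mulVecCLM_apply, Matrix.mulVec_mulVec]

theorem material_eq_mulVecCLM {r u : ℕ} (Γ : Matrix (Fin r) (Fin u) ℝ)
    (y : EuclideanSpace ℝ (Fin r)) : material Γ y = mulVecCLM Γ.transpose y := rfl

theorem embed_eq_mulVecCLM {r u : ℕ} (Γ : Matrix (Fin r) (Fin u) ℝ)
    (v : EuclideanSpace ℝ (Fin u)) : embed Γ v = mulVecCLM Γ v := rfl

variable {u : ℕ} {Ω : Matrix (Fin u) (Fin u) ℝ}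

theorem isUnit_det_sqrt (hΩ : Ω.PosDef) : IsUnit (CFC.sqrt Ω).det := by
  rw [← Matrix.isUnit_iff_isUnit_det]
  exact (CFC.isUnit_sqrt_iff Ω hΩ.posSemidef.nonneg).2 hΩ.isUnit

theorem quadInv_eq_norm_sq (hΩ : Ω.PosDef) (v : EuclideanSpace ℝ (Fin u)) :
    quadInv Ω v = ‖mulVecCLM (CFC.sqrt Ω)⁻¹ v‖ ^ 2 := by
  have hsymm : ((CFC.sqrt Ω)⁻¹).transpose = (CFC.sqrt Ω)⁻¹ := by
    have := (Matrix.PosSemidef.inv (Matrix.nonneg_iff_posSemidef.1 (CFC.sqrt_nonneg Ω))).isHermitian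
    rwa [Matrix.IsHermitian, Matrix.conjTranspose_eq_transpose_of_trivial] at this
  have hinv : Ω⁻¹ = (CFC.sqrt Ω)⁻¹ * (CFC.sqrt Ω)⁻¹ := by
    rw [← Matrix.mul_inv_rev, CFC.sqrt_mul_sqrt_self Ω hΩ.posSemidef.nonneg]
  rw [quadInv, hinv, ← Matrix.mulVec_mulVec, Matrix.dotProduct_mulVec, ← Matrix.mulVec_transpose,
    hsymm, EuclideanSpace.real_norm_sq_eq]
  simp [dotProduct, mulVecCLM_apply, sq]

end Matrices

/-- First-order condition at an extremum without derivatives: for small `t` of the sign of `b` the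
linear term would dominate. The choice `t = b / (|a| + 1)` is small enough. -/
theorem eq_zero_of_forall_mul_le_sq_mul {a b : ℝ} (h : ∀ t : ℝ, 2 * t * b ≤ t ^ 2 * a) : b = 0 := by
  have hs : 0 < |a| + 1 := by positivity
  have h1 := h (b / (|a| + 1))
  rw [div_pow, mul_div_assoc', div_mul_eq_mul_div, div_mul_eq_mul_div,
    div_le_div_iff₀ hs (by positivity)] at h1
  have h2 : b ^ 2 * a ≤ b ^ 2 * (|a| + 1) :=
    mul_le_mul_of_nonneg_left ((le_abs_self a).trans (by linarith)) (sq_nonneg b)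
  have h3 : 2 * b ^ 2 * (|a| + 1) ≤ b ^ 2 * a := by
    refine le_of_mul_le_mul_right ?_ hs
    nlinarith
  have h4 : b ^ 2 * (|a| + 1) ≤ 0 := by linarith
  have h5 : b ^ 2 ≤ 0 := nonpos_of_mul_nonpos_left h4 hs
  exact pow_eq_zero_iff two_ne_zero |>.1 (le_antisymm h5 (sq_nonneg b))

/-! ### The estimator as a tuple of univariate ridge regressions -/

section Estimator

variable {X : Type*} {H : Type*} [NormedAddCommGroup H] [InnerProductSpace ℝ H] [RKHS ℝ H X ℝ]
  {r u n : ℕ} {Γ : Matrix (Fin r) (Fin u) ℝ} {Ω : Matrix (Fin u) (Fin u) ℝ}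

/-- The tuple `A g` with entries `∑ⱼ Aₖⱼ gⱼ`. -/
noncomputable def mulTuple (A : Matrix (Fin u) (Fin u) ℝ) (g : Fin u → H) (k : Fin u) : H :=
  ∑ j, A k j • g j

theorem evalVec_mulTuple (A : Matrix (Fin u) (Fin u) ℝ) (g : Fin u → H) (x : X) :
    evalVec (mulTuple A g) x = mulVecCLM A (evalVec g x) := by
  ext k
  have : mulTuple A g k x = ∑ j, (A k j • g j) x := by
    simp only [mulTuple, ← RKHS.coeCLM_apply (𝕜 := ℝ), map_sum, Finset.sum_apply]
  simp [evalVec, mulVecCLM_apply, Matrix.mulVec, dotProduct, this]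

theorem mulTuple_mulTuple (A B : Matrix (Fin u) (Fin u) ℝ) (g : Fin u → H) :
    mulTuple A (mulTuple B g) = mulTuple (A * B) g := by
  ext1 k
  simp only [mulTuple, Finset.smul_sum, smul_smul, Matrix.mul_apply, Finset.sum_smul]
  exact Finset.sum_comm

theorem mulTuple_one (g : Fin u → H) : mulTuple 1 g = g := by
  ext1 k
  simp [mulTuple, Matrix.one_apply]

/-- The penalized log-likelihood, in terms of the standardized responses and of the standardized
tuple `Ω^{-1/2} g`, is a sum of univariate ridge regression objectives. -/
theorem penalized_eq (hΩ : Ω.PosDef) (lam : ℝ) (data : Fin n → X × EuclideanSpace ℝ (Fin r))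
    (g : Fin u → H) :
    materialLogLik Γ Ω data g - lam / 2 * penalty Ω g = -((n : ℝ) / 2) * Real.log Ω.det -
      1 / 2 * ∑ k, (∑ i, (mulVecCLM ((CFC.sqrt Ω)⁻¹ * Γ.transpose) (data i).2 k
        - mulTuple (CFC.sqrt Ω)⁻¹ g k (data i).1) ^ 2
        + lam * ‖mulTuple (CFC.sqrt Ω)⁻¹ g k‖ ^ 2) := by
  have h1 : ∀ i, quadInv Ω (material Γ (data i).2 - evalVec g (data i).1) =
      ∑ k, (mulVecCLM ((CFC.sqrt Ω)⁻¹ * Γ.transpose) (data i).2 k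
        - mulTuple (CFC.sqrt Ω)⁻¹ g k (data i).1) ^ 2 := by
    intro i
    rw [quadInv_eq_norm_sq hΩ, map_sub, material_eq_mulVecCLM, mulVecCLM_mul, ← evalVec_mulTuple,
      EuclideanSpace.real_norm_sq_eq]
    rfl
  have h2 : penalty Ω g = ∑ k, ‖mulTuple (CFC.sqrt Ω)⁻¹ g k‖ ^ 2 := rfl
  rw [materialLogLik, h2, Finset.sum_add_distrib, Finset.sum_comm, ← Finset.mul_sum]
  simp only [h1]
  ring

/-- The standardized components of a kernel envelope solution solve the normal equations of
univariate kernel ridge regression. -/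
theorem IsKENVSolution.normal_eq (hΩ : Ω.PosDef) {lam : ℝ}
    {data : Fin n → X × EuclideanSpace ℝ (Fin r)} {g : Fin u → H}
    (hg : IsKENVSolution Γ Ω lam data g) (k : Fin u) (η : H) :
    ∑ i, (mulVecCLM ((CFC.sqrt Ω)⁻¹ * Γ.transpose) (data i).2 k
      - mulTuple (CFC.sqrt Ω)⁻¹ g k (data i).1) * η (data i).1 =
      lam * ⟪mulTuple (CFC.sqrt Ω)⁻¹ g k, η⟫ := by
  set h := mulTuple (CFC.sqrt Ω)⁻¹ g
  set w := fun i => mulVecCLM ((CFC.sqrt Ω)⁻¹ * Γ.transpose) (data i).2 k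
  refine sub_eq_zero.1 (eq_zero_of_forall_mul_le_sq_mul
    (a := ∑ i, η (data i).1 ^ 2 + lam * ‖η‖ ^ 2) fun t => ?_)
  -- The competitor perturbs one standardized coordinate; multiplying by `Ω^{1/2}` makes its
  -- standardization exactly the updated tuple, so all terms other than the `k`-th cancel.
  have hmax := isMaxOn_univ_iff.1 hg
    (mulTuple (CFC.sqrt Ω) (Function.update h k (h k + t • η)))
  simp only [penalized_eq hΩ] at hmax
  rw [mulTuple_mulTuple, Matrix.nonsing_inv_mul _ (isUnit_det_sqrt hΩ), mulTuple_one,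
    ← Finset.add_sum_erase _ _ (Finset.mem_univ k),
    ← Finset.add_sum_erase (a := k) (s := Finset.univ) (fun l =>
      ∑ i, (mulVecCLM ((CFC.sqrt Ω)⁻¹ * Γ.transpose) (data i).2 l
        - h l (data i).1) ^ 2 + lam * ‖h l‖ ^ 2) (Finset.mem_univ k)] at hmax
  rw [Finset.sum_congr rfl (s₁ := Finset.univ.erase k) fun l hl => by
    rw [Function.update_of_ne (Finset.ne_of_mem_erase hl)]] at hmax
  rw [Function.update_self] at hmax
  have hle : ∑ i, (w i - h k (data i).1) ^ 2 + lam * ‖h k‖ ^ 2 ≤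
      ∑ i, (w i - (h k + t • η) (data i).1) ^ 2 + lam * ‖h k + t • η‖ ^ 2 := by
    simp only [w]
    linarith
  have hexp : ∑ i, (w i - (h k + t • η) (data i).1) ^ 2 =
      ∑ i, (w i - h k (data i).1) ^ 2 - 2 * t * ∑ i, (w i - h k (data i).1) * η (data i).1
        + t ^ 2 * ∑ i, η (data i).1 ^ 2 := by
    rw [Finset.mul_sum, Finset.mul_sum, ← Finset.sum_sub_distrib, ← Finset.sum_add_distrib]
    refine Finset.sum_congr rfl fun i _ => ?_
    simp
    ring
  rw [hexp, norm_add_sq_real, real_inner_smul_right, norm_smul, mul_pow, Real.norm_eq_abs,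
    sq_abs] at hle
  linarith

end Estimator

/-! ### Continuity, boundedness and density for a universal kernel -/

section Kernel

variable {X : Type*} {H : Type*} [NormedAddCommGroup H] [InnerProductSpace ℝ H] [CompleteSpace H]
  [RKHS ℝ H X ℝ]

theorem inner_kerFun_one (x : X) (h : H) : ⟪RKHS.kerFun H x (1 : ℝ), h⟫ = h x := by
  simp

/-- Uses `‖k_y - k_x‖² = K(y,y) - 2K(y,x) + K(x,x)`. This provides the measurability of the feature
map and, on a compact space, its boundedness. -/
theorem IsUniversal.continuous_kerFun [TopologicalSpace X] (hK : IsUniversal (X := X) H) :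
    Continuous fun x : X => RKHS.kerFun H x (1 : ℝ) := by
  have hker : ∀ x y : X, ⟪RKHS.kerFun H x (1 : ℝ), RKHS.kerFun H y (1 : ℝ)⟫ = kernelFun H x y := by
    intro x y
    rw [inner_kerFun_one, RKHS.kerFun_apply, kernelFun]
  refine continuous_iff_continuousAt.2 fun x => tendsto_iff_norm_sub_tendsto_zero.2 ?_
  have hnorm : ∀ y : X, ‖RKHS.kerFun H y (1 : ℝ) - RKHS.kerFun H x (1 : ℝ)‖ =
      √(kernelFun H y y - 2 * kernelFun H y x + kernelFun H x x) := by
    intro y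
    rw [← hker y y, ← hker y x, ← hker x x, real_inner_self_eq_norm_sq, real_inner_self_eq_norm_sq,
      ← norm_sub_sq_real, Real.sqrt_sq (norm_nonneg _)]
  simp_rw [hnorm]
  have hc : Continuous fun y : X =>
      √(kernelFun H y y - 2 * kernelFun H y x + kernelFun H x x) :=
    (((hK.1.comp (continuous_id.prodMk continuous_id)).sub
      ((hK.1.comp (continuous_id.prodMk continuous_const)).const_mul 2)).add continuous_const).sqrt
  have := hc.tendsto x
  rwa [show kernelFun H x x - 2 * kernelFun H x x + kernelFun H x x = 0 by ring,
    Real.sqrt_zero] at this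

theorem IsUniversal.exists_norm_kerFun_le [TopologicalSpace X] [CompactSpace X]
    (hK : IsUniversal (X := X) H) : ∃ κ : ℝ, ∀ x : X, ‖RKHS.kerFun H x (1 : ℝ)‖ ≤ κ := by
  obtain ⟨κ, hκ⟩ := isCompact_univ.exists_bound_of_continuousOn hK.continuous_kerFun.continuousOn
  exact ⟨κ, fun x => hκ x (Set.mem_univ x)⟩

theorem IsUniversal.continuous_apply [TopologicalSpace X] (hK : IsUniversal (X := X) H) (h : H) :
    Continuous fun x : X => h x := by
  simp_rw [← inner_kerFun_one (H := H)]
  exact hK.continuous_kerFun.inner continuous_const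

/-- The elements of the reproducing kernel Hilbert space of a universal kernel are dense in `L²`. -/
theorem IsUniversal.exists_integral_sub_sq_lt [PseudoMetricSpace X] [CompactSpace X]
    [MeasurableSpace X] [BorelSpace X] (hK : IsUniversal (X := X) H) {ν : Measure X}
    [IsProbabilityMeasure ν] {m : X → ℝ} (hm : MemLp m 2 ν) {δ : ℝ} (hδ : 0 < δ) :
    ∃ h : H, ∫ x, (m x - h x) ^ 2 ∂ν < δ := by
  -- Two approximations, `m` by continuous `φ` in `L²` and `φ` by `h` uniformly, each with squared
  -- error `δ / 8`; with `(a - b)² ≤ 2a² + 2b²` they total at most `δ / 2`.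
  obtain ⟨φ, hφ, hφL⟩ := MemLp.exists_boundedContinuous_integral_rpow_sub_le (μ := ν) (p := 2)
    two_pos (f := m) (by simpa using hm) (ε := δ / 8) (by positivity)
  simp only [Real.rpow_two, Real.norm_eq_abs, sq_abs] at hφ
  obtain ⟨h, hh⟩ := hK.2 φ.toContinuousMap (√(δ / 8)) (by positivity)
  refine ⟨h, ?_⟩
  have hφ2 : MemLp (fun x => m x - φ x) 2 ν := hm.sub (by simpa using hφL)
  have hh2 : MemLp (fun x : X => h x) 2 ν := by
    obtain ⟨C, hC⟩ := isCompact_univ.exists_bound_of_continuousOn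
      (hK.continuous_apply h).continuousOn
    exact MemLp.of_bound (hK.continuous_apply h).aestronglyMeasurable C
      (Eventually.of_forall fun x => hC x (Set.mem_univ x))
  calc ∫ x, (m x - h x) ^ 2 ∂ν ≤ ∫ x, (2 * (m x - φ x) ^ 2 + 2 * (δ / 8)) ∂ν := by
        refine integral_mono (hm.sub hh2).integrable_sq
          ((hφ2.integrable_sq.const_mul 2).add (integrable_const _)) fun x => ?_
        have h1 : (h x - φ x) ^ 2 ≤ δ / 8 := by
          rw [← sq_abs, ← Real.sq_sqrt (by positivity : 0 ≤ δ / 8)]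
          exact pow_le_pow_left₀ (abs_nonneg _) (hh x).le 2
        nlinarith [sq_nonneg ((m x - φ x) + (h x - φ x))]
    _ = 2 * ∫ x, (m x - φ x) ^ 2 ∂ν + 2 * (δ / 8) := by
        rw [integral_add (hφ2.integrable_sq.const_mul 2) (integrable_const _), integral_const_mul]
        simp
    _ < δ := by linarith

end Kernel

/-! ### The envelope model and the decomposition of the risk -/

section Model

variable {p r u k l : ℕ} {𝒳 : Set (EuclideanSpace ℝ (Fin p))}
  {μ : Measure (𝒳 × EuclideanSpace ℝ (Fin r))} {D : Set (EuclideanSpace ℝ (Fin p))}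
  {f : EuclideanSpace ℝ (Fin p) → EuclideanSpace ℝ (Fin r)}
  {Sig : Matrix (Fin r) (Fin r) ℝ} {Γ : Matrix (Fin r) (Fin u) ℝ}

theorem IsEnvelopeModel.posDef_materialCov (hmodel : IsEnvelopeModel μ D f Sig Γ) :
    (materialCov Sig Γ).PosDef := by
  have hinj : Function.Injective Γ.mulVec := by
    intro v v' h
    have := congrArg (Γ.transpose.mulVec) h
    simpa [Matrix.mulVec_mulVec, hmodel.basis.1] using this
  have := hmodel.posDef.conjTranspose_mul_mul_same hinj
  rwa [Matrix.conjTranspose_eq_transpose_of_trivial] at this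

/-- `f x` lies in every subspace of the defining intersection, hence in the column span of `Γ`, on
which `Γ Γᵀ` is the identity. This is how the envelope enters the whole-response claim. -/
theorem IsEnvelopeModel.embed_material (hmodel : IsEnvelopeModel μ D f Sig Γ) (x : 𝒳) :
    embed Γ (material Γ (f x)) = f x := by
  have hmem : f x ∈ envelope Sig f D :=
    (Submodule.mem_sInf).2 fun R hR => hR.2 x (hmodel.subset_domain x.2)
  rw [← hmodel.basis.2] at hmem
  generalize f x = v at hmem ⊢
  induction hmem using Submodule.span_induction with
  | mem v hv =>
    obtain ⟨j, rfl⟩ := hv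
    have h1 : Γ.transpose.mulVec (fun i => Γ i j) = Pi.single j 1 := by
      have : (fun i => Γ i j) = Γ.mulVec (Pi.single j 1) := by
        simp [Matrix.col_def]
        rfl
      rw [this, Matrix.mulVec_mulVec, hmodel.basis.1, Matrix.one_mulVec]
    ext i
    simp [embed, material, h1]
  | zero => simp [embed, material]
  | add v w _ _ hv hw =>
    nth_rw 2 [← hv, ← hw]
    simp only [embed, material, WithLp.ofLp_add, Matrix.mulVec_add, WithLp.toLp_add]
  | smul c v _ hv =>
    nth_rw 2 [← hv]
    simp only [embed, material, WithLp.ofLp_smul, Matrix.mulVec_smul, WithLp.toLp_smul]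

/-- A component of a linear transformation of the error is uncorrelated with every square
integrable function of the predictor. -/
theorem IsEnvelopeModel.integral_clm_error_mul (hmodel : IsEnvelopeModel μ D f Sig Γ)
    [IsProbabilityMeasure μ]
    (ℓ : EuclideanSpace ℝ (Fin r) →L[ℝ] ℝ) {q : 𝒳 → ℝ} (hq : Measurable q) :
    ∫ z, ℓ (error f z) * q z.1 ∂μ = 0 := by
  have hind : IndepFun (fun z => ℓ (error f z)) (fun z => q z.1) μ :=
    hmodel.indep.comp (φ := ℓ) (ψ := q) ℓ.continuous.measurable hq
  rw [hind.integral_fun_mul_eq_mul_integral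
    (ℓ.continuous.comp_aestronglyMeasurable hmodel.memLp_error.1)
    (hq.comp measurable_fst).aestronglyMeasurable,
    ℓ.integral_comp_comm (hmodel.memLp_error.integrable one_le_two), hmodel.mean_error]
  simp

variable [IsProbabilityMeasure μ]
  {A : EuclideanSpace ℝ (Fin r) →L[ℝ] EuclideanSpace ℝ (Fin l)}
  {B : EuclideanSpace ℝ (Fin k) →L[ℝ] EuclideanSpace ℝ (Fin l)}
  {L : EuclideanSpace ℝ (Fin r) → EuclideanSpace ℝ (Fin k) → ℝ}
  {m : EuclideanSpace ℝ (Fin p) → EuclideanSpace ℝ (Fin k)}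

theorem IsEnvelopeModel.loss_eq (hL : ∀ y v, L y v = ‖A y - B v‖ ^ 2)
    (hfm : ∀ x : 𝒳, A (f x) = B (m x)) (g : 𝒳 → EuclideanSpace ℝ (Fin k))
    (z : 𝒳 × EuclideanSpace ℝ (Fin r)) :
    L z.2 (g z.1) = ‖A (error f z) + B (m z.1 - g z.1)‖ ^ 2 := by
  rw [hL, error, map_sub, map_sub, hfm]
  congr 2
  abel

/-- The risk is the sum of the irreducible error and the mean square distance to the regression
function. -/
theorem IsEnvelopeModel.risk_eq (hmodel : IsEnvelopeModel μ D f Sig Γ)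
    (hL : ∀ y v, L y v = ‖A y - B v‖ ^ 2) (hm : Measurable m)
    (hfm : ∀ x : 𝒳, A (f x) = B (m x)) {g : 𝒳 → EuclideanSpace ℝ (Fin k)} (hg : Measurable g)
    (hmg : MemLp (fun z => B (m z.1 - g z.1)) 2 μ) :
    risk μ L g = ENNReal.ofReal
      (∫ z, ‖A (error f z)‖ ^ 2 ∂μ + ∫ z, ‖B (m z.1 - g z.1)‖ ^ 2 ∂μ) := by
  have hε : MemLp (fun z => A (error f z)) 2 μ := A.comp_memLp' hmodel.memLp_error
  have hεsq := (memLp_two_iff_integrable_sq_norm hε.1).1 hε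
  have hmgsq := (memLp_two_iff_integrable_sq_norm hmg.1).1 hmg
  have hcross := (integrable_inner_of_memLp_two hε hmg).const_mul 2
  -- The cross term is a sum over coordinates of centred noise times a function of the predictor, so
  -- independence kills it.
  have hcross0 : ∫ z, ⟪A (error f z), B (m z.1 - g z.1)⟫ ∂μ = 0 := by
    have hcoord : ∀ i : Fin l, ∫ z, A (error f z) i * B (m z.1 - g z.1) i ∂μ = 0 := fun i =>
      hmodel.integral_clm_error_mul ((EuclideanSpace.proj i).comp A)
        (q := fun x => B (m x - g x) i)
        ((((EuclideanSpace.proj i).comp B).continuous.measurable).comp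
          ((hm.comp measurable_subtype_coe).sub hg))
    simp_rw [PiLp.inner_apply]
    rw [integral_finsetSum]
    · refine Finset.sum_eq_zero fun i _ => ?_
      rw [← hcoord i]
      exact integral_congr_ae (Eventually.of_forall fun z => by simp [mul_comm])
    · exact fun i _ => integrable_inner_of_memLp_two (hε.eval_piLp i) (hmg.eval_piLp i)
  simp_rw [risk, loss_eq hL hfm]
  have hsum : Integrable (fun z => ‖A (error f z) + B (m z.1 - g z.1)‖ ^ 2) μ :=
    (memLp_two_iff_integrable_sq_norm (hε.add hmg).1).1 (hε.add hmg)
  rw [← ofReal_integral_eq_lintegral_ofReal hsum (Eventually.of_forall fun z => sq_nonneg _)]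
  have hadd : Integrable (fun z => ‖A (error f z)‖ ^ 2 +
      2 * ⟪A (error f z), B (m z.1 - g z.1)⟫) μ := hεsq.add hcross
  simp_rw [norm_add_sq_real]
  rw [integral_add hadd hmgsq, integral_add hεsq hcross, integral_const_mul, hcross0,
    mul_zero, add_zero]

/-- For an arbitrary measurable `g` the decomposition is not available outright. If the risk is
finite, however, `B (m - g)` is the difference of two square integrable functions, and `risk_eq`
applies. -/
theorem IsEnvelopeModel.le_risk (hmodel : IsEnvelopeModel μ D f Sig Γ)
    (hL : ∀ y v, L y v = ‖A y - B v‖ ^ 2) (hm : Measurable m)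
    (hfm : ∀ x : 𝒳, A (f x) = B (m x)) {g : 𝒳 → EuclideanSpace ℝ (Fin k)} (hg : Measurable g) :
    ENNReal.ofReal (∫ z, ‖A (error f z)‖ ^ 2 ∂μ) ≤ risk μ L g := by
  by_cases hfin : risk μ L g = ∞
  · simp [hfin]
  have hε : MemLp (fun z => A (error f z)) 2 μ := A.comp_memLp' hmodel.memLp_error
  have hmeas : AEStronglyMeasurable (fun z : 𝒳 × EuclideanSpace ℝ (Fin r) => B (m z.1 - g z.1)) μ :=
    (B.continuous.measurable.comp (((hm.comp measurable_subtype_coe).sub hg).comp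
      measurable_fst)).aestronglyMeasurable
  have hsum : MemLp (fun z => A (error f z) + B (m z.1 - g z.1)) 2 μ := by
    have hsm := hε.1.add hmeas
    refine (memLp_two_iff_integrable_sq_norm hsm).2 ⟨(hsm.norm.pow 2), ?_⟩
    rw [hasFiniteIntegral_iff_ofReal (Eventually.of_forall fun z => sq_nonneg _)]
    simp_rw [risk, loss_eq hL hfm] at hfin
    exact lt_top_iff_ne_top.2 hfin
  have hmg : MemLp (fun z => B (m z.1 - g z.1)) 2 μ := by
    have := hsum.sub hε
    refine this.ae_eq (Eventually.of_forall fun z => ?_)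
    simp
  rw [hmodel.risk_eq hL hm hfm hg hmg]
  exact ENNReal.ofReal_le_ofReal (le_add_of_nonneg_right (integral_nonneg fun z => sq_nonneg _))

theorem IsEnvelopeModel.optimalRisk_eq (hmodel : IsEnvelopeModel μ D f Sig Γ)
    (hL : ∀ y v, L y v = ‖A y - B v‖ ^ 2) (hm : Measurable m)
    (hfm : ∀ x : 𝒳, A (f x) = B (m x)) :
    optimalRisk k μ L = ENNReal.ofReal (∫ z, ‖A (error f z)‖ ^ 2 ∂μ) := by
  refine le_antisymm ((iInf₂_le m hm).trans ?_) (le_iInf₂ fun g hg =>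
    hmodel.le_risk hL hm hfm (hg.comp measurable_subtype_coe))
  rw [hmodel.risk_eq hL hm hfm (g := fun x => m x) (hm.comp measurable_subtype_coe) (by simp)]
  simp

/-- Risk consistency follows from convergence in mean square to the regression function. -/
theorem IsEnvelopeModel.isRiskConsistent (hmodel : IsEnvelopeModel μ D f Sig Γ)
    (hL : ∀ y v, L y v = ‖A y - B v‖ ^ 2) (hm : Measurable m)
    (hfm : ∀ x : 𝒳, A (f x) = B (m x)) {S : Type*} [MeasurableSpace S] {P : Measure S}
    {ghat : ℕ → S → 𝒳 → EuclideanSpace ℝ (Fin k)} (hg : ∀ n ω, Measurable (ghat n ω))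
    (hmg : ∀ n ω, MemLp (fun z => B (m z.1 - ghat n ω z.1)) 2 μ)
    (hlim : TendstoInMeasure P (fun n ω => ∫ z, ‖B (m z.1 - ghat n ω z.1)‖ ^ 2 ∂μ) atTop
      (fun _ => 0)) :
    IsRiskConsistent P μ L ghat := by
  have hopt := hmodel.optimalRisk_eq hL hm hfm
  have hrisk := fun n ω => hmodel.risk_eq hL hm hfm (hg n ω) (hmg n ω)
  refine ⟨by simp [hopt], fun n => Eventually.of_forall fun ω => by simp [hrisk], ?_⟩
  rw [tendstoInMeasure_iff_norm] at hlim ⊢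
  have h0 : 0 ≤ ∫ z, ‖A (error f z)‖ ^ 2 ∂μ := integral_nonneg fun z => sq_nonneg _
  have h1 : ∀ n ω, 0 ≤ ∫ z, ‖B (m z.1 - ghat n ω z.1)‖ ^ 2 ∂μ := fun n ω =>
    integral_nonneg fun z => sq_nonneg _
  simp_rw [hopt, hrisk, ENNReal.toReal_ofReal h0, ENNReal.toReal_ofReal (add_nonneg h0 (h1 _ _)),
    add_sub_cancel_left]
  simpa using hlim

end Model

/-! ### Convergence in probability to zero: domination and finite sums -/

section ConvergenceInMeasure

variable {S : Type*} [MeasurableSpace S] {P : Measure S}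

theorem tendstoInMeasure_zero_of_le_mul {F G : ℕ → S → ℝ} {C : ℝ} (hF : ∀ n ω, 0 ≤ F n ω)
    (hFG : ∀ n ω, F n ω ≤ C * G n ω) (hG : TendstoInMeasure P G atTop (fun _ => 0)) :
    TendstoInMeasure P F atTop (fun _ => 0) := by
  rw [tendstoInMeasure_iff_norm] at hG ⊢
  intro ε hε
  have hs : 0 < |C| + 1 := by positivity
  refine tendsto_of_tendsto_of_tendsto_of_le_of_le tendsto_const_nhds (hG (ε / (|C| + 1))
    (by positivity)) (fun n => zero_le) fun n => measure_mono fun ω hω => ?_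
  simp only [Set.mem_ofPred_eq, sub_zero, Real.norm_eq_abs] at hω ⊢
  rw [abs_of_nonneg (hF n ω)] at hω
  rw [div_le_iff₀ hs]
  calc ε ≤ C * G n ω := hω.trans (hFG n ω)
    _ ≤ |C * G n ω| := le_abs_self _
    _ = |C| * |G n ω| := abs_mul _ _
    _ ≤ |G n ω| * (|C| + 1) := by nlinarith [abs_nonneg (G n ω)]

theorem tendstoInMeasure_zero_sum {ι : Type*} (s : Finset ι) {F : ι → ℕ → S → ℝ}
    (hF : ∀ i ∈ s, TendstoInMeasure P (F i) atTop (fun _ => 0)) :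
    TendstoInMeasure P (fun n ω => ∑ i ∈ s, F i n ω) atTop (fun _ => 0) := by
  classical
  induction s using Finset.induction_on with
  | empty =>
    rw [tendstoInMeasure_iff_norm]
    intro ε hε
    simp [hε.not_ge]
  | insert a s ha ih =>
    have h1 := hF a (Finset.mem_insert_self a s)
    have h2 := ih fun i hi => hF i (Finset.mem_insert_of_mem hi)
    rw [tendstoInMeasure_iff_norm] at h1 h2 ⊢
    intro ε hε
    have hlim := (h1 (ε / 2) (half_pos hε)).add (h2 (ε / 2) (half_pos hε))
    rw [add_zero] at hlim
    refine tendsto_of_tendsto_of_tendsto_of_le_of_le tendsto_const_nhds hlim (fun n => zero_le)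
      fun n => (measure_mono fun ω hω => ?_).trans (measure_union_le _ _)
    simp only [Set.mem_ofPred_eq, sub_zero, Finset.sum_insert ha, Set.mem_union] at hω ⊢
    by_contra! hcon
    linarith [norm_add_le (F a n ω) (∑ i ∈ s, F i n ω)]

end ConvergenceInMeasure

/-- With `q = λ / n^{3/4}`, eventually `q ≥ 1`, so `q ≤ q² = λ² / n^{3/2} ≤ λ² / n`. -/
theorem tendsto_sq_div_atTop {lam : ℕ → ℝ}
    (hlam : Tendsto (fun n : ℕ => lam n / (n : ℝ) ^ (3 / 4 : ℝ)) atTop atTop) :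
    Tendsto (fun n : ℕ => lam n ^ 2 / (n : ℝ)) atTop atTop := by
  refine tendsto_atTop_mono' atTop ?_ hlam
  filter_upwards [hlam.eventually_ge_atTop 1, eventually_ge_atTop 1] with n hn hn1
  have hn' : (1 : ℝ) ≤ n := by exact_mod_cast hn1
  have hpow : 0 < (n : ℝ) ^ (3 / 4 : ℝ) := Real.rpow_pos_of_pos (by linarith) _
  have hle : (n : ℝ) ≤ ((n : ℝ) ^ (3 / 4 : ℝ)) ^ 2 := by
    rw [← Real.rpow_natCast, ← Real.rpow_mul (by linarith)]
    exact Real.self_le_rpow_of_one_le hn' (by norm_num)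
  calc lam n / (n : ℝ) ^ (3 / 4 : ℝ) ≤ (lam n / (n : ℝ) ^ (3 / 4 : ℝ)) ^ 2 :=
        le_self_pow₀ hn two_ne_zero
    _ = lam n ^ 2 / ((n : ℝ) ^ (3 / 4 : ℝ)) ^ 2 := div_pow _ _ _
    _ ≤ lam n ^ 2 / n := by gcongr

/-! ### Consistency of the kernel envelope estimate -/

section Consistency

variable {p r u : ℕ} {𝒳 : Set (EuclideanSpace ℝ (Fin p))}
  {H : Type*} [NormedAddCommGroup H] [InnerProductSpace ℝ H] [CompleteSpace H] [RKHS ℝ H 𝒳 ℝ]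
  {μ : Measure (𝒳 × EuclideanSpace ℝ (Fin r))}
  {D : Set (EuclideanSpace ℝ (Fin p))}
  {f : EuclideanSpace ℝ (Fin p) → EuclideanSpace ℝ (Fin r)}
  {Sig : Matrix (Fin r) (Fin r) ℝ} {Γ : Matrix (Fin r) (Fin u) ℝ}

theorem IsEnvelopeModel.memLp_regression (hmodel : IsEnvelopeModel μ D f Sig Γ)
    (hy : ∀ j : Fin r, MemLp (fun z : 𝒳 × EuclideanSpace ℝ (Fin r) => z.2 j) 2 μ) :
    MemLp (fun z : 𝒳 × EuclideanSpace ℝ (Fin r) => f z.1) 2 μ := by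
  have hy' : MemLp (fun z : 𝒳 × EuclideanSpace ℝ (Fin r) => z.2) 2 μ := MemLp.of_eval_piLp hy
  refine (hy'.sub hmodel.memLp_error).ae_eq (Eventually.of_forall fun z => ?_)
  simp [error]

variable [IsProbabilityMeasure μ]

/-- Each component of the standardized kernel envelope estimate converges in mean square to the
regression function of the standardized response. -/
theorem IsEnvelopeModel.tendstoInMeasure_component [CompactSpace 𝒳]
    (hK : IsUniversal (X := 𝒳) H) (hmodel : IsEnvelopeModel μ D f Sig Γ)
    (hy : ∀ j : Fin r, MemLp (fun z : 𝒳 × EuclideanSpace ℝ (Fin r) => z.2 j) 2 μ)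
    {S : Type*} [MeasurableSpace S] {P : Measure S} [IsProbabilityMeasure P]
    {Z : ℕ → S → 𝒳 × EuclideanSpace ℝ (Fin r)}
    (hZ_law : ∀ i, HasLaw (Z i) μ P) (hZ_indep : iIndepFun Z P)
    {lam : ℕ → ℝ} (hlam_pos : ∀ n, 0 < lam n)
    (hlam_zero : Tendsto (fun n : ℕ => lam n / (n : ℝ)) atTop (𝓝 0))
    (hlam_top : Tendsto (fun n : ℕ => lam n / (n : ℝ) ^ (3 / 4 : ℝ)) atTop atTop)
    {ghat : ℕ → S → Fin u → H}
    (hghat : ∀ n, ∀ᵐ ω ∂P, IsKENVSolution Γ (materialCov Sig Γ) (lam n)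
      (fun i : Fin n => Z i ω) (ghat n ω)) (k : Fin u) :
    TendstoInMeasure P (fun n ω =>
      ∫ z, (mulVecCLM ((CFC.sqrt (materialCov Sig Γ))⁻¹ * Γ.transpose) (f z.1) k
        - mulTuple (CFC.sqrt (materialCov Sig Γ))⁻¹ (ghat n ω) k z.1) ^ 2 ∂μ) atTop
      (fun _ => 0) := by
  have hΩ := hmodel.posDef_materialCov
  set A := mulVecCLM ((CFC.sqrt (materialCov Sig Γ))⁻¹ * Γ.transpose)
  obtain ⟨κ, hκ⟩ := hK.exists_norm_kerFun_le
  have hΦ : AEStronglyMeasurable (fun z : 𝒳 × EuclideanSpace ℝ (Fin r) =>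
      RKHS.kerFun H z.1 (1 : ℝ)) μ :=
    (hK.continuous_kerFun.stronglyMeasurable.comp_measurable measurable_fst).aestronglyMeasurable
  have hy' : MemLp (fun z : 𝒳 × EuclideanSpace ℝ (Fin r) => z.2) 2 μ := MemLp.of_eval_piLp hy
  have hw : MemLp (fun z : 𝒳 × EuclideanSpace ℝ (Fin r) => A z.2 k) 2 μ :=
    (A.comp_memLp' hy').eval_piLp k
  have hm : MemLp (fun z : 𝒳 × EuclideanSpace ℝ (Fin r) => A (f z.1) k) 2 μ :=
    (A.comp_memLp' (hmodel.memLp_regression hy)).eval_piLp k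
  have hmain := tendstoInMeasure_ridge (κ := κ) (P := P) (Z := Z)
    (Φ := fun z : 𝒳 × EuclideanSpace ℝ (Fin r) => RKHS.kerFun H z.1 (1 : ℝ))
    (h := fun n ω => mulTuple (CFC.sqrt (materialCov Sig Γ))⁻¹ (ghat n ω) k)
    hw hm hΦ (fun z => hκ z.1) ?_ ?_ hZ_law hZ_indep hlam_pos hlam_zero
    (tendsto_sq_div_atTop hlam_top) ?_
  · simpa only [inner_kerFun_one] using hmain
  · intro η
    simp_rw [inner_kerFun_one]
    rw [← hmodel.integral_clm_error_mul ((EuclideanSpace.proj k).comp A)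
      (hK.continuous_apply η).measurable]
    refine integral_congr_ae (Eventually.of_forall fun z => ?_)
    simp [error]
  · intro δ hδ
    -- Density in `L²` is applied on `𝒳` with the marginal law of `x`, then pulled back to the joint
    -- law.
    have : IsProbabilityMeasure (μ.map Prod.fst) :=
      Measure.isProbabilityMeasure_map measurable_fst.aemeasurable
    have hmeas : Measurable fun x : 𝒳 => A (f x) k :=
      ((EuclideanSpace.proj (𝕜 := ℝ) k).comp A).continuous.measurable.comp
        (hmodel.measurable_regression.comp measurable_subtype_coe)
    obtain ⟨h, hh⟩ := hK.exists_integral_sub_sq_lt (ν := μ.map Prod.fst)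
      (m := fun x => A (f x) k)
      ((memLp_map_measure_iff hmeas.aestronglyMeasurable measurable_fst.aemeasurable).2 hm) hδ
    refine ⟨h, ?_⟩
    have hsq : Measurable fun x : 𝒳 => (A (f x) k - h x) ^ 2 :=
      (hmeas.sub (hK.continuous_apply h).measurable).pow_const 2
    rw [integral_map measurable_fst.aemeasurable hsq.aestronglyMeasurable] at hh
    simpa only [inner_kerFun_one] using hh
  · intro n
    filter_upwards [hghat n] with ω hω η
    simpa only [inner_kerFun_one] using hω.normal_eq hΩ k η

theorem IsUniversal.measurable_evalVec (hK : IsUniversal (X := 𝒳) H) (g : Fin u → H) :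
    Measurable (evalVec g) :=
  ((PiLp.continuous_toLp 2 _).comp (continuous_pi fun j => hK.continuous_apply (g j))).measurable

theorem IsUniversal.memLp_evalVec [CompactSpace 𝒳] (hK : IsUniversal (X := 𝒳) H)
    (g : Fin u → H) :
    MemLp (fun z : 𝒳 × EuclideanSpace ℝ (Fin r) => evalVec g z.1) 2 μ := by
  have hcont : Continuous (evalVec g) :=
    (PiLp.continuous_toLp 2 _).comp (continuous_pi fun j => hK.continuous_apply (g j))
  obtain ⟨C, hC⟩ := isCompact_univ.exists_bound_of_continuousOn hcont.continuousOn
  exact MemLp.of_bound (hcont.measurable.comp measurable_fst).aestronglyMeasurable C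
    (Eventually.of_forall fun z => hC z.1 (Set.mem_univ _))

end Consistency

end KENV

open KENV

theorem mainTheorem1 {p r u : ℕ}
    -- the compact predictor domain and an RKHS of a universal kernel on it
    (𝒳 : Set (EuclideanSpace ℝ (Fin p))) (h𝒳 : IsCompact 𝒳)
    {H : Type*} [NormedAddCommGroup H] [InnerProductSpace ℝ H] [CompleteSpace H]
    [RKHS ℝ H 𝒳 ℝ] (hK : KENV.IsUniversal H)
    -- the joint law of (x, y), following the envelope model, with finite second moments
    (μ : Measure (𝒳 × EuclideanSpace ℝ (Fin r))) [IsProbabilityMeasure μ]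
    (D : Set (EuclideanSpace ℝ (Fin p)))
    (f : EuclideanSpace ℝ (Fin p) → EuclideanSpace ℝ (Fin r))
    (Sig : Matrix (Fin r) (Fin r) ℝ) (Γ : Matrix (Fin r) (Fin u) ℝ)
    (hmodel : KENV.IsEnvelopeModel μ D f Sig Γ)
    (hy : ∀ j : Fin r, MemLp (fun z : 𝒳 × EuclideanSpace ℝ (Fin r) => z.2 j) 2 μ)
    -- an i.i.d. sample from that law
    {S : Type*} [MeasurableSpace S] (P : Measure S) [IsProbabilityMeasure P]
    (Z : ℕ → S → 𝒳 × EuclideanSpace ℝ (Fin r))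
    (hZ_law : ∀ i, HasLaw (Z i) μ P) (hZ_indep : iIndepFun Z P)
    -- the penalty parameters
    (lam : ℕ → ℝ) (hlam_pos : ∀ n, 0 < lam n)
    (hlam_zero : Tendsto (fun n : ℕ => lam n / (n : ℝ)) atTop (𝓝 0))
    (hlam_top : Tendsto (fun n : ℕ => lam n / (n : ℝ) ^ (3 / 4 : ℝ)) atTop atTop)
    -- the estimates computed from the first n observations
    (ghat : ℕ → S → Fin u → H)
    (hghat : ∀ n, ∀ᵐ ω ∂P, KENV.IsKENVSolution Γ (KENV.materialCov Sig Γ) (lam n)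
      (fun i : Fin n => Z i ω) (ghat n ω)) :
    KENV.IsRiskConsistent P μ (KENV.standardizedLoss Γ (KENV.materialCov Sig Γ))
        (fun n ω => KENV.evalVec (ghat n ω)) ∧
      KENV.IsRiskConsistent P μ KENV.squaredLoss
        (fun n ω x => KENV.embed Γ (KENV.evalVec (ghat n ω) x)) := by
  have : CompactSpace 𝒳 := isCompact_iff_compactSpace.1 h𝒳
  have hΩ := hmodel.posDef_materialCov
  have hf := hmodel.memLp_regression hy
  set R := CFC.sqrt (materialCov Sig Γ)
  have hMf : ∀ x : 𝒳, mulVecCLM (R⁻¹ * Γ.transpose) (f x) = mulVecCLM R⁻¹ (material Γ (f x)) :=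
    fun x => by rw [material_eq_mulVecCLM, mulVecCLM_mul]
  have hres : ∀ n ω, MemLp (fun z : 𝒳 × EuclideanSpace ℝ (Fin r) =>
      mulVecCLM R⁻¹ (material Γ (f z.1) - evalVec (ghat n ω) z.1)) 2 μ := fun n ω =>
    (mulVecCLM R⁻¹).comp_memLp' (((mulVecCLM Γ.transpose).comp_memLp' hf).sub
      (hK.memLp_evalVec (ghat n ω)))
  have hlim : TendstoInMeasure P (fun n ω =>
      ∫ z, ‖mulVecCLM R⁻¹ (material Γ (f z.1) - evalVec (ghat n ω) z.1)‖ ^ 2 ∂μ) atTop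
      (fun _ => 0) := by
    have hsum := tendstoInMeasure_zero_sum Finset.univ fun k _ =>
      hmodel.tendstoInMeasure_component hK hy hZ_law hZ_indep hlam_pos hlam_zero hlam_top hghat k
    refine hsum.congr_left fun n => Eventually.of_forall fun ω => ?_
    have hcoord : ∀ z : 𝒳 × EuclideanSpace ℝ (Fin r), ∀ k,
        mulVecCLM R⁻¹ (material Γ (f z.1) - evalVec (ghat n ω) z.1) k =
          mulVecCLM (R⁻¹ * Γ.transpose) (f z.1) k - mulTuple R⁻¹ (ghat n ω) k z.1 := by
      intro z k
      rw [map_sub, ← hMf, ← evalVec_mulTuple]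
      rfl
    simp_rw [EuclideanSpace.real_norm_sq_eq, hcoord]
    rw [integral_finsetSum]
    intro k _
    simp_rw [← hcoord]
    exact ((hres n ω).eval_piLp k).integrable_sq
  constructor
  · refine hmodel.isRiskConsistent (A := mulVecCLM (R⁻¹ * Γ.transpose)) (B := mulVecCLM R⁻¹)
      (m := fun x => material Γ (f x)) (fun y v => ?_)
      ((mulVecCLM Γ.transpose).continuous.measurable.comp hmodel.measurable_regression) hMf
      (fun n ω => hK.measurable_evalVec (ghat n ω)) hres hlim
    rw [standardizedLoss, quadInv_eq_norm_sq hΩ, map_sub, material_eq_mulVecCLM, mulVecCLM_mul]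
  · refine hmodel.isRiskConsistent (A := ContinuousLinearMap.id ℝ _)
      (B := ContinuousLinearMap.id ℝ _) (m := f) (fun y v => rfl) hmodel.measurable_regression
      (fun x => rfl) (fun n ω => (mulVecCLM Γ).continuous.measurable.comp
        (hK.measurable_evalVec (ghat n ω)))
      (fun n ω => hf.sub ((mulVecCLM Γ).comp_memLp' (hK.memLp_evalVec (ghat n ω)))) ?_
    -- The whole-response error is the image under `Γ R = Γ Ω^{1/2}` of the standardized error,
    -- since `Γ Γᵀ f = f` on `𝒳`.
    refine tendstoInMeasure_zero_of_le_mul (C := ‖mulVecCLM (Γ * R)‖ ^ 2)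
      (fun n ω => integral_nonneg fun z => sq_nonneg _) (fun n ω => ?_) hlim
    rw [← integral_const_mul]
    refine integral_mono_of_nonneg (Eventually.of_forall fun z => sq_nonneg _)
      (((memLp_two_iff_integrable_sq_norm (hres n ω).1).1 (hres n ω)).const_mul _)
      (Eventually.of_forall fun z => ?_)
    have heq : f z.1 - embed Γ (evalVec (ghat n ω) z.1) =
        mulVecCLM (Γ * R) (mulVecCLM R⁻¹ (material Γ (f z.1) - evalVec (ghat n ω) z.1)) := by
      rw [mulVecCLM_mul, Matrix.mul_nonsing_inv_cancel_right _ _ (isUnit_det_sqrt hΩ), map_sub,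
        ← embed_eq_mulVecCLM, ← embed_eq_mulVecCLM, hmodel.embed_material]
    simp only [ContinuousLinearMap.id_apply]
    rw [heq, ← mul_pow]
    exact pow_le_pow_left₀ (norm_nonneg _) ((mulVecCLM (Γ * R)).le_opNorm _) 2
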